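/- There is a function $C\colon \mathbb{R}\to\mathbb{R}$, $p\mapsto C_p$, with $C_p>0$ for $1<p<2$ and $C_p\to 0$ as $p\downarrow 1$, such that the following holds. Let $q>2$ be an even integer and $p=q/(q-1)$. Let $\mathbb{K}$ be a countable set, $\Phi=(\phi_k)_{k\in\mathbb{K}}\colon\mathcal{X}\to\ell^q(\mathbb{K})$ a feature map, $x_1,\dots,x_n\in\mathcal{X}$, $y\in\mathbb{R}^n$ and $\gamma>0$. Consider the primal problem $$\min_{w\in\ell^p(\mathbb{K})} F(w),\qquad F(w)=\frac{\gamma}{2}\sum_{i=1}^n\big(y_i-\langle\Phi(x_i),w\rangle\big)^2+\frac1p\|w\|_p^p ,$$ the tensor kernel $K(x'_1,\dots,x'_q)=\sum_{k\in\mathbb{K}}\phi_k(x'_1)\cdots\phi_k(x'_q)$ and the dual problem $$\min_{\alpha\in\mathbb{R}^n}\Lambda(\alpha),\qquad \Lambda(\alpha)=\frac1q\sum_{i_1,\dots,i_q=1}^n K(x_{i_1},\dots,x_{i_q})\,\alpha_{i_1}\cdots\alpha_{i_q}+\frac1{2\gamma}\|\alpha\|_2^2-\langle y,\alpha\rangle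 .$$ Let $\delta,\theta\in(0,1)$, $0<\bar\lambda<\gamma/(2(1-\delta))$ and $\alpha_0\in\mathbb{R}^n$. Dual gradient descent with backtracking linesearch is the following algorithm. For $m=0,1,2,\dots$ put $$\omega_{m,j}=\sum_{i_1,\dots,i_{q-1}=1}^n K(x_{i_1},\dots,x_{i_{q-1}},x_j)\,\alpha_{m,i_1}\cdots\alpha_{m,i_{q-1}},\qquad g_m=\omega_m-y+\gamma^{-1}\alpha_m ;$$ start from $\lambda_m:=\bar\lambda$, and as long as $\Lambda(\alpha_m)-\Lambda(\alpha_m-\lambda_m g_m)<\lambda_m(1-\delta)\|g_m\|_2^2$ replace $\lambda_m$ by $\theta\lambda_m$; then put $\alpha_{m+1}=(1-\lambda_m\gamma^{-1})\alpha_m-\lambda_m(\omega_m-y)$. Let $J_q(u)=(\operatorname{sign}(u_k)|u_k|^{q-1})_{k\in\mathbb{K}}$, which maps $\ell^q(\mathbb{K})$ to $\ell^p(\mathbb{K})$, and let $w_m=J_q\big(\sum_{i=1}^n\alpha_{m,i}\Phi(x_i)\big)$. Then $g_m=\nabla\Lambda(\alpha_m)$, the inner loop always terminates (so that the sequences $(\alpha_m)$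 and $(\lambda_m)$ are well defined), the primal problem has a unique solution $\bar w$, the dual problem has a unique solution, and $\inf_m\lambda_m>0$. Moreover, for every $m\in\mathbb{N}$, $$\|w_m-\bar w\|_p^2\le\frac{\big[(2^pq)\big(\Lambda(\alpha_0)+\frac{\gamma}{2}\|y\|_2^2\big)\big]^{\frac{2-p}{p}}}{C_p}\cdot\prod_{i=0}^{m-1}\Big(1-\frac2\gamma\lambda_i(1-\delta)\Big)\cdot\big(\Lambda(\alpha_0)-\min\Lambda\big).$$ In particular the product may be replaced by $\big(1-\frac2\gamma\lambda_m(1-\delta)\big)^m$ for every $m$ such that $\lambda_m\le\lambda_i$ for all $i<m$, and, for every $m$, by $\rho^m$ with $\rho=1-\frac2\gamma\big(\inf_i\lambda_i\big)(1-\delta)\in[0,1)$. Therefore $w_m$ converges linearly to $\bar w$. -/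

import Mathlib

open Set Filter Topology
open scoped ENNReal

noncomputable section

namespace TensorKernel

-- For conjugate exponents `p, q` and `u ∈ ℓ^q`, the sequence `sign(u_k) |u_k|^(q-1)` is in `ℓ^p`.
theorem memlp_duality {𝕂 : Type*} {p : ℝ} {q : ℕ} (hpq : p.HolderConjugate (q : ℝ))
    (u : lp (fun _ : 𝕂 => ℝ) (q : ℝ≥0∞)) :
    Memℓp (fun k => Real.sign (u k) * |u k| ^ (q - 1)) (ENNReal.ofReal p) := by
  have hp : 0 < p := hpq.pos
  have hq1 : (1 : ℝ) < q := hpq.symm.lt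
  have hqn : 1 < q := by exact_mod_cast hq1
  have hmul : ((q : ℝ) - 1) * p = q := by
    have := hpq.symm.sub_one_mul_conj
    exact this
  have hu := lp.memℓp u
  rw [memℓp_gen_iff (by simpa using hq1.trans' one_pos)] at hu
  rw [memℓp_gen_iff (by simpa [ENNReal.toReal_ofReal hp.le] using hp)]
  refine Summable.of_nonneg_of_le (fun k => by positivity) (fun k => ?_) hu
  rw [ENNReal.toReal_ofReal hp.le, ENNReal.toReal_natCast, norm_mul, norm_pow, norm_abs_eq_norm]
  have h1 : ‖Real.sign (u k)‖ ≤ 1 := by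
    rcases Real.sign_apply_eq (u k) with h | h | h <;> simp [h]
  calc (‖Real.sign (u k)‖ * ‖u k‖ ^ (q - 1)) ^ p ≤ (1 * ‖u k‖ ^ (q - 1)) ^ p := by gcongr
    _ = ‖u k‖ ^ (q : ℝ) := by
      rw [one_mul, ← Real.rpow_natCast, ← Real.rpow_mul (norm_nonneg _),
        Nat.cast_sub hqn.le, Nat.cast_one, hmul]

/-- The duality map `J_q : ℓ^q(𝕂) → ℓ^p(𝕂)`, `J_q(u)_k = sign(u_k) |u_k|^(q-1)`. -/
def dualityMap {𝕂 : Type*} {p : ℝ} {q : ℕ} (hpq : p.HolderConjugate (q : ℝ))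
    (u : lp (fun _ : 𝕂 => ℝ) (q : ℝ≥0∞)) : lp (fun _ : 𝕂 => ℝ) (ENNReal.ofReal p) :=
  ⟨fun k => Real.sign (u k) * |u k| ^ (q - 1), memlp_duality hpq u⟩

/-- The pairing `⟨u, w⟩ = ∑_k u_k w_k` of `u ∈ ℓ^q(𝕂)` and `w ∈ ℓ^p(𝕂)`. -/
def pairing {𝕂 : Type*} {q p : ℝ≥0∞} (u : lp (fun _ : 𝕂 => ℝ) q) (w : lp (fun _ : 𝕂 => ℝ) p) : ℝ :=
  ∑' k, u k * w k

/-- The primal objective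
`F(w) = (γ/2) ∑_i (y_i - ⟨Φ(x_i), w⟩)² + (1/p) ‖w‖_p^p` on `ℓ^p(𝕂)`. -/
def primalObj {𝕂 X : Type*} {q : ℕ} {n : ℕ} (p γ : ℝ) (Φ : X → lp (fun _ : 𝕂 => ℝ) (q : ℝ≥0∞))
    (x : Fin n → X) (y : EuclideanSpace ℝ (Fin n))
    (w : lp (fun _ : 𝕂 => ℝ) (ENNReal.ofReal p)) : ℝ :=
  γ / 2 * ∑ i, (y i - pairing (Φ (x i)) w) ^ 2 + 1 / p * ‖w‖ ^ p

/-- The tensor kernel `K(x'_1, …, x'_q) = ∑_k φ_k(x'_1) ⋯ φ_k(x'_q)`, where `Φ = (φ_k)_k`. -/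
def tensorKernel {𝕂 X : Type*} {q : ℕ} (Φ : X → lp (fun _ : 𝕂 => ℝ) (q : ℝ≥0∞))
    (z : Fin q → X) : ℝ :=
  ∑' k, ∏ s, Φ (z s) k

/-- The Gram tensor of order `q`: the values `K(x_{i_1}, …, x_{i_q})` at the training points. -/
def gramTensor {𝕂 X : Type*} {q n : ℕ} (Φ : X → lp (fun _ : 𝕂 => ℝ) (q : ℝ≥0∞))
    (x : Fin n → X) (i : Fin q → Fin n) : ℝ :=
  tensorKernel Φ (fun s => x (i s))

/-- The dual objective, written through a tensor `G` of order `q`: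
`Λ(α) = (1/q) ∑_{i_1,…,i_q} G(i_1,…,i_q) α_{i_1} ⋯ α_{i_q} + (1/(2γ)) ‖α‖² - ⟨y, α⟩`. -/
def dualObj {q n : ℕ} (γ : ℝ) (G : (Fin q → Fin n) → ℝ) (y α : EuclideanSpace ℝ (Fin n)) : ℝ :=
  1 / (q : ℝ) * ∑ i : Fin q → Fin n, G i * ∏ s, α (i s)
    + 1 / (2 * γ) * ‖α‖ ^ 2 - inner ℝ y α

/-- The multi-index `(i_1, …, i_{q-1}, j)`. -/
def lastIndex {q n : ℕ} (i : Fin (q - 1) → Fin n) (j : Fin n) : Fin q → Fin n :=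
  fun s => if h : s.1 < q - 1 then i ⟨s.1, h⟩ else j

/-- The vector `ω(α)` with
`ω_j = ∑_{i_1,…,i_{q-1}} G(i_1,…,i_{q-1},j) α_{i_1} ⋯ α_{i_{q-1}}`. -/
def omega {q n : ℕ} (G : (Fin q → Fin n) → ℝ) (α : EuclideanSpace ℝ (Fin n)) :
    EuclideanSpace ℝ (Fin n) :=
  WithLp.toLp 2 fun j => ∑ i : Fin (q - 1) → Fin n, G (lastIndex i j) * ∏ s, α (i s)

/-- The gradient of the dual objective as it is computed by the algorithm, `ω(α) - y + γ⁻¹ α`. -/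
def dualGrad {q n : ℕ} (γ : ℝ) (G : (Fin q → Fin n) → ℝ) (y α : EuclideanSpace ℝ (Fin n)) :
    EuclideanSpace ℝ (Fin n) :=
  omega G α - y + γ⁻¹ • α

/-- The condition of the `while` loop of the linesearch at the point `α` for the stepsize `l`:
`Λ(α) - Λ(α - l ∇Λ(α)) < l (1 - δ) ‖∇Λ(α)‖²`; the stepsize is reduced as long as it holds. -/
def Rejected {q n : ℕ} (γ δ : ℝ) (G : (Fin q → Fin n) → ℝ) (y α : EuclideanSpace ℝ (Fin n))
    (l : ℝ) : Prop :=
  dualObj γ G y α - dualObj γ G y (α - l • dualGrad γ G y α)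
    < l * (1 - δ) * ‖dualGrad γ G y α‖ ^ 2

/-- `α` and `lam` are the sequences of iterates and of stepsizes that dual gradient descent with
backtracking linesearch generates from `α₀`: at every step the loop starts from `lamBar` and
multiplies the trial stepsize by `θ` until it is no longer rejected. -/
structure IsGenerated {q n : ℕ} (γ δ θ lamBar : ℝ) (G : (Fin q → Fin n) → ℝ)
    (y α₀ : EuclideanSpace ℝ (Fin n)) (α : ℕ → EuclideanSpace ℝ (Fin n)) (lam : ℕ → ℝ) :
    Prop where
  init : α 0 = α₀
  linesearch : ∀ m, ∃ j : ℕ, lam m = lamBar * θ ^ j ∧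
    ¬ Rejected γ δ G y (α m) (lamBar * θ ^ j) ∧
    ∀ i < j, Rejected γ δ G y (α m) (lamBar * θ ^ i)
  update : ∀ m, α (m + 1) = (1 - lam m * γ⁻¹) • α m - lam m • (omega G (α m) - y)

/-- The primal point `w = J_q(∑_i α_i Φ(x_i))` that belongs to a dual vector `α`. -/
def primalPoint {𝕂 X : Type*} {p : ℝ} {q n : ℕ} (hpq : p.HolderConjugate (q : ℝ))
    (Φ : X → lp (fun _ : 𝕂 => ℝ) (q : ℝ≥0∞)) (x : Fin n → X) (α : EuclideanSpace ℝ (Fin n)) :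
    lp (fun _ : 𝕂 => ℝ) (ENNReal.ofReal p) :=
  dualityMap hpq (∑ i, α i • Φ (x i))

end TensorKernel

end

/-! With `u = ∑ α_i Φ(x_i)`, expanding `u_k ^ q` and summing over `k` turns the tensor term of the
dual into `‖u‖_q^q / q`. Hence the dual objective equals its linearization plus `‖b - a‖² / (2γ)`
plus a sum of scalar Bregman distances of `t ^ q / q` (`dualObj_bregman`). This identity drives the
proof in two ways.

Dropping the Bregman part leaves strong convexity with modulus `1/γ`, so a Polyak–Łojasiewicz
inequality holds. Combined with the linesearch decrease, it contracts the dual gap by `1 -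
2λ(1-δ)/γ` per step (`dualObj_sub_le`). The steps stay away from zero because the gradient is
Lipschitz on a ball containing the initial sublevel set and the trial points.

Dropping the quadratic part at the minimizer bounds the Bregman sum by the dual gap. A scalar
estimate of `(a^(q-1) - b^(q-1))²` by the Bregman distance, summed by Hölder, then bounds `‖J_q u -
J_q v‖_p²` (`norm_dualityMap_sub_sq_le`). Primal optimality of `J_q u` comes from the equality case
of Young's inequality, whose defect is again a Bregman distance. -/

noncomputable section
namespace TensorKernel

/-! ### Scalar inequalities for `t ^ q / q` -/

/-- The Bregman distance of `t ↦ t ^ q / q`. -/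
def powBregman (q : ℕ) (a b : ℝ) : ℝ := a ^ q / q - b ^ q / q - b ^ (q - 1) * (a - b)

/-- As a function of `a`, right side minus left side vanishes at `b`, and its derivative is a
product of two factors that are nonnegative on `[b, a]`. -/
theorem sq_pow_sub_pow_le_of_le {r : ℕ} (hr : Even r) {a b M : ℝ} (hab : b ≤ a)
    (ha : |a| ≤ M) (hb : |b| ≤ M) :
    (a ^ (r + 1) - b ^ (r + 1)) ^ 2 ≤ 2 * (r + 1) * M ^ r * powBregman (r + 2) a b := by
  have hq : ((r + 2 : ℕ) : ℝ) ≠ 0 := by positivity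
  let f : ℝ → ℝ := fun s =>
    2 * (r + 1) * M ^ r * powBregman (r + 2) s b - (s ^ (r + 1) - b ^ (r + 1)) ^ 2
  have hd : ∀ s, HasDerivAt f
      (2 * (r + 1) * (M ^ r - s ^ r) * (s ^ (r + 1) - b ^ (r + 1))) s := by
    intro s
    have h1 : HasDerivAt (fun s : ℝ => powBregman (r + 2) s b) (s ^ (r + 1) - b ^ (r + 1)) s := by
      have h := (((hasDerivAt_pow (r + 2) s).div_const ((r + 2 : ℕ) : ℝ)).sub_const
        (b ^ (r + 2) / ((r + 2 : ℕ) : ℝ))).sub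
        (((hasDerivAt_id s).sub_const b).const_mul (b ^ (r + 1)))
      refine h.congr_deriv ?_
      rw [show r + 2 - 1 = r + 1 from rfl]
      field_simp
    have h2 := (((hasDerivAt_pow (r + 1) s).sub_const (b ^ (r + 1))).pow 2)
    refine ((h1.const_mul (2 * (r + 1) * M ^ r)).sub h2).congr_deriv ?_
    simp only [Nat.add_sub_cancel]
    push_cast
    ring
  have hmono : MonotoneOn f (Icc b a) := by
    refine monotoneOn_of_deriv_nonneg (convex_Icc b a)
      (fun s _ => (hd s).continuousAt.continuousWithinAt)
      (fun s _ => (hd s).differentiableAt.differentiableWithinAt) fun s hs => ?_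
    rw [interior_Icc] at hs
    rw [(hd s).deriv]
    have hsM : |s| ≤ M := abs_le.2 ⟨by linarith [(abs_le.1 hb).1, hs.1],
      by linarith [(abs_le.1 ha).2, hs.2]⟩
    have h1 : s ^ r ≤ M ^ r := by
      rw [← hr.pow_abs]; exact pow_le_pow_left₀ (abs_nonneg s) hsM r
    have h2 : b ^ (r + 1) ≤ s ^ (r + 1) := (hr.add_one.strictMono_pow).monotone hs.1.le
    exact mul_nonneg (mul_nonneg (by positivity) (sub_nonneg.2 h1)) (sub_nonneg.2 h2)
  have h := hmono (left_mem_Icc.2 hab) (right_mem_Icc.2 hab) hab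
  have hfb : f b = 0 := by simp [f, powBregman]
  rw [hfb] at h
  exact sub_nonneg.1 h

theorem powBregman_neg {q : ℕ} (hq : Even q) (hq0 : 0 < q) (a b : ℝ) :
    powBregman q (-a) (-b) = powBregman q a b := by
  have : Odd (q - 1) := Nat.Even.sub_odd hq0 hq odd_one
  simp only [powBregman, hq.neg_pow, this.neg_pow]
  ring

/-- Negating both arguments preserves both sides, which reduces the claim to `b ≤ a`. -/
theorem sq_pow_sub_pow_le {q : ℕ} (hq : Even q) (hq2 : 2 < q) (a b : ℝ) :
    (a ^ (q - 1) - b ^ (q - 1)) ^ 2 ≤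
      2 * (q - 1) * max |a| |b| ^ (q - 2) * powBregman q a b := by
  obtain ⟨r, rfl⟩ : ∃ r, q = r + 2 := ⟨q - 2, by omega⟩
  have hr : Even r := by simpa [parity_simps] using hq
  have e : ((r + 2 : ℕ) : ℝ) - 1 = r + 1 := by push_cast; ring
  rw [e, Nat.add_sub_cancel, show r + 2 - 1 = r + 1 from rfl]
  rcases le_total b a with h | h
  · exact sq_pow_sub_pow_le_of_le hr h (le_max_left _ _) (le_max_right _ _)
  · have := sq_pow_sub_pow_le_of_le hr (neg_le_neg h) (M := max |a| |b|)
      (by rw [abs_neg]; exact le_max_left _ _) (by rw [abs_neg]; exact le_max_right _ _)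
    rw [powBregman_neg hq (by omega), hr.add_one.neg_pow, hr.add_one.neg_pow] at this
    linarith

theorem powBregman_nonneg {q : ℕ} (hq : Even q) (hq2 : 2 < q) (a b : ℝ) :
    0 ≤ powBregman q a b := by
  rcases (le_max_of_le_left (abs_nonneg a) : 0 ≤ max |a| |b|).eq_or_lt with h | h
  · have ha : a = 0 := abs_nonpos_iff.1 (h ▸ le_max_left _ _)
    have hb : b = 0 := abs_nonpos_iff.1 (h ▸ le_max_right _ _)
    simp [powBregman, ha, hb]
  · have hq' : (2 : ℝ) < q := by exact_mod_cast hq2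
    have := (sq_nonneg _).trans (sq_pow_sub_pow_le hq hq2 a b)
    exact nonneg_of_mul_nonneg_right this
      (mul_pos (by linarith) (pow_pos h _))

theorem pow_eq_pow_of_powBregman_eq_zero {q : ℕ} (hq : Even q) (hq2 : 2 < q) {a b : ℝ}
    (h : powBregman q a b = 0) : a ^ (q - 1) = b ^ (q - 1) := by
  have := sq_pow_sub_pow_le hq hq2 a b
  rw [h, mul_zero] at this
  exact sub_eq_zero.1 (pow_eq_zero_iff two_ne_zero |>.1 (le_antisymm this (sq_nonneg _)))

theorem sign_mul_abs_pow {m : ℕ} (hm : Odd m) (t : ℝ) : Real.sign t * |t| ^ m = t ^ m := by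
  rcases lt_trichotomy t 0 with h | h | h
  · rw [Real.sign_of_neg h, abs_of_neg h, hm.neg_pow]; ring
  · simp [h, hm.pos.ne']
  · rw [Real.sign_of_pos h, abs_of_pos h, one_mul]

theorem exists_pow_eq_of_odd {m : ℕ} (hm : Odd m) (t : ℝ) : ∃ s : ℝ, s ^ m = t := by
  have h0 : m ≠ 0 := hm.pos.ne'
  rcases le_total 0 t with h | h
  · exact ⟨t ^ (m⁻¹ : ℝ), Real.rpow_inv_natCast_pow h h0⟩
  · refine ⟨-(-t) ^ (m⁻¹ : ℝ), ?_⟩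
    rw [hm.neg_pow, Real.rpow_inv_natCast_pow (neg_nonneg.2 h) h0, neg_neg]

theorem abs_pow_sub_one_rpow {p : ℝ} {q : ℕ} (hpq : p.HolderConjugate (q : ℝ)) (t : ℝ) :
    |t ^ (q - 1)| ^ p = |t| ^ q := by
  have hq1 : 1 < q := by exact_mod_cast hpq.symm.lt
  rw [abs_pow, ← Real.rpow_natCast, ← Real.rpow_mul (abs_nonneg _), Nat.cast_sub hq1.le,
    Nat.cast_one, hpq.symm.sub_one_mul_conj, Real.rpow_natCast]

/-- The defect in Young's inequality is a Bregman distance. -/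
theorem young_defect {p : ℝ} {q : ℕ} (hpq : p.HolderConjugate (q : ℝ)) (hq : Even q) (s t : ℝ) :
    |s ^ (q - 1)| ^ p / p + |t| ^ q / q - t * s ^ (q - 1) = powBregman q t s := by
  have hq1 : 1 < q := by exact_mod_cast hpq.symm.lt
  rw [abs_pow_sub_one_rpow hpq, hq.pow_abs, hq.pow_abs, powBregman]
  have h1 : s ^ (q - 1) * s = s ^ q := by rw [← pow_succ, Nat.sub_add_cancel hq1.le]
  have h2 : p⁻¹ = 1 - (q : ℝ)⁻¹ := by linarith [hpq.inv_add_inv_eq_one]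
  rw [div_eq_mul_inv _ p, h2, div_eq_mul_inv, div_eq_mul_inv, mul_sub, mul_sub, h1]
  ring

theorem abs_mul_pow_le {q : ℕ} (hq : 0 < q) (s t : ℝ) :
    |s * t ^ (q - 1)| ≤ |s| ^ q + |t| ^ q := by
  rw [abs_mul, abs_pow]
  have e : ∀ c : ℝ, c * c ^ (q - 1) = c ^ q := fun c => by
    rw [← pow_succ', Nat.sub_add_cancel hq]
  rcases le_total |s| |t| with h | h
  · calc |s| * |t| ^ (q - 1) ≤ |t| * |t| ^ (q - 1) := by gcongr
      _ ≤ _ := by rw [e]; linarith [pow_nonneg (abs_nonneg s) q]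
  · calc |s| * |t| ^ (q - 1) ≤ |s| * |s| ^ (q - 1) := by gcongr
      _ ≤ _ := by rw [e]; linarith [pow_nonneg (abs_nonneg t) q]

/-! ### Strong convexity through subgradients -/

section StronglyConvex

variable {E : Type*} [NormedAddCommGroup E] [InnerProductSpace ℝ E] {f : E → ℝ} {g : E → E} {γ : ℝ}

/-- `g` is a selection of subgradients for which `f` is strongly convex with modulus `γ⁻¹`. -/
def IsStrongSubgradient (γ : ℝ) (f : E → ℝ) (g : E → E) : Prop :=
  ∀ a b, f a + inner ℝ (g a) (b - a) + 1 / (2 * γ) * ‖b - a‖ ^ 2 ≤ f b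

namespace IsStrongSubgradient

theorem inner_le (h : IsStrongSubgradient γ f g) (hγ : 0 < γ) (a b : E) :
    f a + inner ℝ (g a) (b - a) ≤ f b := by
  have : 0 ≤ 1 / (2 * γ) * ‖b - a‖ ^ 2 := by positivity
  linarith [h a b]

theorem sub_le_inner (h : IsStrongSubgradient γ f g) (hγ : 0 < γ) (a b : E) :
    f b - f a - inner ℝ (g a) (b - a) ≤ inner ℝ (g b - g a) (b - a) := by
  have := h.inner_le hγ b a
  rw [← neg_sub b a, inner_neg_right] at this
  rw [inner_sub_left]
  linarith

/-- The linearization error lies between `0` and `⟨g b - g a, b - a⟩`, which is `o(‖b - a‖)` by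
continuity of `g`. -/
theorem hasGradientAt [CompleteSpace E] (h : IsStrongSubgradient γ f g) (hγ : 0 < γ)
    (hg : Continuous g) (a : E) : HasGradientAt f (g a) a := by
  rw [hasGradientAt_iff_hasFDerivAt, hasFDerivAt_iff_isLittleO, Asymptotics.isLittleO_iff]
  intro c hc
  filter_upwards [Metric.tendsto_nhds.1 (hg.tendsto a) c hc] with b hb
  rw [InnerProductSpace.toDual_apply_apply, Real.norm_of_nonneg (by linarith [h.inner_le hγ a b])]
  refine (h.sub_le_inner hγ a b).trans ((real_inner_le_norm _ _).trans ?_)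
  rw [dist_eq_norm] at hb
  gcongr

theorem eq_of_isMinOn [CompleteSpace E] (h : IsStrongSubgradient γ f g) (hγ : 0 < γ)
    (hg : Continuous g) {a : E} (ha : IsMinOn f univ a) : g a = 0 := by
  have h0 := (ha.isLocalMin univ_mem).hasFDerivAt_eq_zero (h.hasGradientAt hγ hg a).hasFDerivAt
  simpa using h0

theorem isMinOn_of_eq (h : IsStrongSubgradient γ f g) (hγ : 0 < γ) {a : E} (ha : g a = 0) :
    IsMinOn f univ a := fun b _ => by
  simpa [ha] using h.inner_le hγ a b

theorem norm_sub_sq_le (h : IsStrongSubgradient γ f g) (hγ : 0 < γ) {a : E} (ha : g a = 0)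
    (b : E) : ‖b - a‖ ^ 2 ≤ 2 * γ * (f b - f a) := by
  have := h a b
  rw [ha, inner_zero_left, add_zero, one_div, inv_mul_eq_div, ← le_sub_iff_add_le',
    div_le_iff₀ (by positivity)] at this
  linarith

theorem eq_zero_unique (h : IsStrongSubgradient γ f g) (hγ : 0 < γ) {a b : E} (ha : g a = 0)
    (hb : g b = 0) : b = a := by
  have h1 := h.norm_sub_sq_le hγ ha b
  have h2 : f b ≤ f a := h.isMinOn_of_eq hγ hb (mem_univ a)
  have h3 : ‖b - a‖ ^ 2 ≤ 0 := h1.trans (mul_nonpos_of_nonneg_of_nonpos (by positivity) (by linarith))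
  exact sub_eq_zero.1 (norm_eq_zero.1 (pow_eq_zero_iff two_ne_zero |>.1
    (le_antisymm h3 (sq_nonneg _))))

/-- Quadratic growth gives `f b ≥ f 0` once `‖b‖ ≥ 2γ‖g 0‖`, so a minimizer exists. -/
theorem exists_eq_zero [FiniteDimensional ℝ E] (h : IsStrongSubgradient γ f g) (hγ : 0 < γ)
    (hg : Continuous g) : ∃ a, g a = 0 := by
  have hc : Continuous f := continuous_iff_continuousAt.2 fun a =>
    (h.hasGradientAt hγ hg a).hasFDerivAt.continuousAt
  obtain ⟨a, ha⟩ := hc.exists_forall_le' 0 (by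
    filter_upwards [(tendsto_norm_cocompact_atTop (E := E)).eventually_ge_atTop (2 * γ * ‖g 0‖)]
      with b hb
    have h1 := h 0 b
    rw [sub_zero] at h1
    have h2 := abs_le.1 (abs_real_inner_le_norm (g 0) b)
    have h3 : ‖g 0‖ * ‖b‖ ≤ 1 / (2 * γ) * ‖b‖ ^ 2 := by
      rw [one_div, inv_mul_eq_div, le_div_iff₀ (by positivity)]
      nlinarith [norm_nonneg b]
    linarith [h2.1])
  exact ⟨a, h.eq_of_isMinOn hγ hg fun b _ => ha b⟩

/-- The Polyak–Łojasiewicz inequality. -/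
theorem sub_le_norm_sq (h : IsStrongSubgradient γ f g) (hγ : 0 < γ) (a b : E) :
    f a - f b ≤ γ / 2 * ‖g a‖ ^ 2 := by
  have h1 := h a b
  -- The strong convexity lower bound for `f b`, as a function of `b`, is smallest at `b = a - γ
  -- g(a)`; this square is the excess over that minimum.
  have h2 : 0 ≤ 1 / (2 * γ) * ‖γ • g a + (b - a)‖ ^ 2 := by positivity
  rw [norm_add_sq_real, norm_smul, real_inner_smul_left, Real.norm_of_nonneg hγ.le] at h2
  have h3 : 1 / (2 * γ) * ((γ * ‖g a‖) ^ 2 + 2 * (γ * inner ℝ (g a) (b - a)) + ‖b - a‖ ^ 2)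
      = γ / 2 * ‖g a‖ ^ 2 + inner ℝ (g a) (b - a) + 1 / (2 * γ) * ‖b - a‖ ^ 2 := by
    field_simp
  linarith

/-- Small steps along the negative gradient give sufficient decrease, uniformly on sublevel sets. -/
theorem exists_sufficient_decrease [FiniteDimensional ℝ E] (h : IsStrongSubgradient γ f g)
    (hγ : 0 < γ) (hg : ContDiff ℝ 1 g) {δ : ℝ} (hδ : 0 < δ) (c : ℝ) :
    ∃ t : ℝ, 0 < t ∧ ∀ a, f a ≤ c → ∀ l, 0 < l → l ≤ t →
      l * (1 - δ) * ‖g a‖ ^ 2 ≤ f a - f (a - l • g a) := by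
  obtain ⟨z, hz⟩ := h.exists_eq_zero hγ hg.continuous
  obtain ⟨B, hB⟩ := (isCompact_closedBall z (Real.sqrt (2 * γ * (c - f z)))).exists_bound_of_continuousOn
    hg.continuous.continuousOn
  -- Quadratic growth puts the sublevel set in the ball of radius `R`, where `‖g‖ ≤ B`; a step of
  -- length `l ≤ 1` therefore stays in the ball of radius `R + B`.
  set R := Real.sqrt (2 * γ * (c - f z))
  obtain ⟨K, hK⟩ := hg.contDiffOn.exists_lipschitzOnWith (s := Metric.closedBall z (R + B))
    one_ne_zero (convex_closedBall _ _) (isCompact_closedBall _ _)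
  have hK0 : (0 : ℝ) ≤ K := K.2
  -- The bound `1` keeps the trial point in the larger ball; `δ / (K + 1)` gives `l K ≤ δ`, with `+
  -- 1` guarding against `K = 0`.
  refine ⟨min 1 (δ / (K + 1)), by positivity, fun a ha l hl hlt => ?_⟩
  have hl1 : l ≤ 1 := hlt.trans (min_le_left _ _)
  have hl2 : l * K ≤ δ := by
    have := (le_div_iff₀ (by positivity)).1 (hlt.trans (min_le_right _ _))
    linarith
  have hR : ‖a - z‖ ≤ R := Real.le_sqrt_of_sq_le ((h.norm_sub_sq_le hγ hz a).trans (by gcongr))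
  have haR : a ∈ Metric.closedBall z R := by rwa [mem_closedBall_iff_norm]
  have hga := hB a haR
  have hB0 : 0 ≤ B := (norm_nonneg _).trans hga
  have e : a - l • g a - a = -(l • g a) := by abel
  have hn : ‖l • g a‖ = l * ‖g a‖ := by rw [norm_smul, Real.norm_of_nonneg hl.le]
  have hb : a - l • g a ∈ Metric.closedBall z (R + B) := by
    rw [mem_closedBall_iff_norm]
    calc ‖a - l • g a - z‖ = ‖(a - z) - l • g a‖ := by congr 1; abel
      _ ≤ ‖a - z‖ + ‖l • g a‖ := norm_sub_le _ _
      _ ≤ R + 1 * B := by rw [hn]; gcongr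
      _ = R + B := by ring
  have hlip := hK.norm_sub_le hb (Metric.closedBall_subset_closedBall (by linarith) haR)
  have h1 := (h.sub_le_inner hγ a (a - l • g a)).trans (real_inner_le_norm _ _)
  rw [e] at h1 hlip
  rw [norm_neg, hn] at h1 hlip
  rw [inner_neg_right, real_inner_smul_right, real_inner_self_eq_norm_sq] at h1
  have h2 : ‖g (a - l • g a) - g a‖ * (l * ‖g a‖) ≤ δ * (l * ‖g a‖ ^ 2) :=
    calc _ ≤ K * (l * ‖g a‖) * (l * ‖g a‖) := by gcongr
      _ = (l * K) * (l * ‖g a‖ ^ 2) := by ring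
      _ ≤ _ := by gcongr
  linarith

end IsStrongSubgradient

end StronglyConvex

/-! ### Backtracking linesearch and decay of the dual gap -/

section Linesearch

variable {q n : ℕ} {γ δ θ lamBar : ℝ} {G : (Fin q → Fin n) → ℝ} {y : EuclideanSpace ℝ (Fin n)}

theorem update_eq (l : ℝ) (a : EuclideanSpace ℝ (Fin n)) :
    (1 - l * γ⁻¹) • a - l • (omega G a - y) = a - l • dualGrad γ G y a := by
  rw [dualGrad]
  module

theorem exists_stepsize_bound (h : IsStrongSubgradient γ (dualObj γ G y) (dualGrad γ G y))
    (hγ : 0 < γ) (hg : ContDiff ℝ 1 (dualGrad γ G y)) (hδ : 0 < δ) (hθ : 0 < θ) (hθ1 : θ < 1)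
    (hl : 0 < lamBar) (c : ℝ) :
    ∃ t : ℝ, 0 < t ∧ ∀ a, dualObj γ G y a ≤ c →
      (∃ j : ℕ, ¬ Rejected γ δ G y a (lamBar * θ ^ j)) ∧
      ∀ j : ℕ, (∀ i < j, Rejected γ δ G y a (lamBar * θ ^ i)) → t ≤ lamBar * θ ^ j := by
  obtain ⟨t, ht, hacc⟩ := h.exists_sufficient_decrease hγ hg hδ c
  -- Either the first trial `lamBar` is reached without any rejection, or the preceding trial was
  -- rejected and so exceeded `t`; one factor `θ` is then lost.
  refine ⟨min lamBar (t * θ), by positivity, fun a ha => ⟨?_, fun j hj => ?_⟩⟩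
  · obtain ⟨j, hj⟩ := exists_pow_lt_of_lt_one (div_pos ht hl) hθ1
    rw [lt_div_iff₀' hl] at hj
    exact ⟨j, not_lt.2 (hacc a ha _ (by positivity) hj.le)⟩
  · rcases j with _ | j
    · simp
    · refine (min_le_right _ _).trans ?_
      have : t ≤ lamBar * θ ^ j := by
        by_contra! hlt
        exact not_lt.2 (hacc a ha _ (by positivity) hlt.le) (hj j j.lt_succ_self)
      rw [pow_succ, ← mul_assoc]
      gcongr

/-- The accepted exponent is the first non-rejected one, hence a function of the current point, and
the recursion is deterministic. -/
theorem existsUnique_isGenerated (h : IsStrongSubgradient γ (dualObj γ G y) (dualGrad γ G y))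
    (hγ : 0 < γ) (hg : ContDiff ℝ 1 (dualGrad γ G y)) (hδ : 0 < δ) (hθ : 0 < θ) (hθ1 : θ < 1)
    (hl : 0 < lamBar) (α₀ : EuclideanSpace ℝ (Fin n)) :
    ∃! s : (ℕ → EuclideanSpace ℝ (Fin n)) × (ℕ → ℝ),
      IsGenerated γ δ θ lamBar G y α₀ s.1 s.2 := by
  classical
  have hex : ∀ a, ∃ j : ℕ, ¬ Rejected γ δ G y a (lamBar * θ ^ j) := fun a => by
    obtain ⟨t, -, ht⟩ := exists_stepsize_bound h hγ hg hδ hθ hθ1 hl (dualObj γ G y a)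
    exact (ht a le_rfl).1
  let S : EuclideanSpace ℝ (Fin n) → ℝ := fun a => lamBar * θ ^ Nat.find (hex a)
  let A : ℕ → EuclideanSpace ℝ (Fin n) := fun m =>
    Nat.rec α₀ (fun _ a => (1 - S a * γ⁻¹) • a - S a • (omega G a - y)) m
  refine ⟨(A, fun m => S (A m)), ⟨rfl, fun m => ⟨Nat.find (hex (A m)), rfl,
    Nat.find_spec (hex (A m)), fun i hi => not_not.1 (Nat.find_min (hex (A m)) hi)⟩,
    fun m => rfl⟩, ?_⟩
  rintro ⟨α, lam⟩ hs
  replace hs : IsGenerated γ δ θ lamBar G y α₀ α lam := hs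
  have hlam : ∀ m, lam m = S (α m) := fun m => by
    obtain ⟨j, hj, hacc, hrej⟩ := hs.linesearch m
    rw [hj, show j = Nat.find (hex (α m)) from
      ((Nat.find_eq_iff (hex (α m))).2 ⟨hacc, fun i hi => not_not.2 (hrej i hi)⟩).symm]
  have hα : ∀ m, α m = A m := fun m => by
    induction m with
    | zero => exact hs.init
    | succ m ih =>
      have h1 : α (m + 1) = (1 - lam m * γ⁻¹) • α m - lam m • (omega G (α m) - y) := hs.update m
      rw [h1, hlam m, ih]
  refine Prod.ext (funext hα) (funext fun m => ?_)
  change lam m = S (A m)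
  rw [hlam m, hα m]

namespace IsGenerated

variable {α₀ : EuclideanSpace ℝ (Fin n)} {α : ℕ → EuclideanSpace ℝ (Fin n)} {lam : ℕ → ℝ}

theorem stepsize_pos (hs : IsGenerated γ δ θ lamBar G y α₀ α lam) (hθ : 0 < θ) (hl : 0 < lamBar)
    (m : ℕ) : 0 < lam m := by
  obtain ⟨j, hj, -⟩ := hs.linesearch m
  rw [hj]
  positivity

theorem stepsize_le (hs : IsGenerated γ δ θ lamBar G y α₀ α lam) (hθ : 0 < θ) (hθ1 : θ < 1)
    (hl : 0 < lamBar) (m : ℕ) : lam m ≤ lamBar := by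
  obtain ⟨j, hj, -⟩ := hs.linesearch m
  rw [hj]
  exact mul_le_of_le_one_right hl.le (pow_le_one₀ hθ.le hθ1.le)

theorem decrease (hs : IsGenerated γ δ θ lamBar G y α₀ α lam) (m : ℕ) :
    lam m * (1 - δ) * ‖dualGrad γ G y (α m)‖ ^ 2 ≤
      dualObj γ G y (α m) - dualObj γ G y (α (m + 1)) := by
  obtain ⟨j, hj, hacc, -⟩ := hs.linesearch m
  rw [hs.update m, update_eq, hj]
  exact not_lt.1 hacc

/-- All iterates stay in the initial sublevel set, so one stepsize bound serves every step. -/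
theorem dualObj_le (hs : IsGenerated γ δ θ lamBar G y α₀ α lam) (hδ1 : δ < 1) (hθ : 0 < θ)
    (hl : 0 < lamBar) (m : ℕ) : dualObj γ G y (α m) ≤ dualObj γ G y α₀ := by
  induction m with
  | zero => rw [hs.init]
  | succ m ih =>
    have h1 := hs.decrease m
    have h2 : 0 ≤ lam m * (1 - δ) * ‖dualGrad γ G y (α m)‖ ^ 2 :=
      mul_nonneg (mul_nonneg (hs.stepsize_pos hθ hl m).le (by linarith)) (sq_nonneg _)
    linarith

theorem iInf_stepsize_pos (hs : IsGenerated γ δ θ lamBar G y α₀ α lam)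
    (h : IsStrongSubgradient γ (dualObj γ G y) (dualGrad γ G y))
    (hγ : 0 < γ) (hg : ContDiff ℝ 1 (dualGrad γ G y)) (hδ : 0 < δ) (hδ1 : δ < 1) (hθ : 0 < θ)
    (hθ1 : θ < 1) (hl : 0 < lamBar) : 0 < ⨅ m, lam m := by
  obtain ⟨t, ht, hb⟩ := exists_stepsize_bound h hγ hg hδ hθ hθ1 hl (dualObj γ G y α₀)
  refine ht.trans_le (le_ciInf fun m => ?_)
  obtain ⟨j, hj, -, hrej⟩ := hs.linesearch m
  rw [hj]
  exact (hb _ (hs.dualObj_le hδ1 hθ hl m)).2 j hrej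

theorem iInf_stepsize_le (hs : IsGenerated γ δ θ lamBar G y α₀ α lam) (hθ : 0 < θ)
    (hl : 0 < lamBar) (m : ℕ) : ⨅ i, lam i ≤ lam m :=
  ciInf_le ⟨0, by rintro _ ⟨i, rfl⟩; exact (hs.stepsize_pos hθ hl i).le⟩ m

theorem factor_nonneg (hs : IsGenerated γ δ θ lamBar G y α₀ α lam) (hγ : 0 < γ) (hδ1 : δ < 1)
    (hθ : 0 < θ) (hθ1 : θ < 1) (hl : 0 < lamBar) (hl2 : lamBar < γ / (2 * (1 - δ))) (m : ℕ) :
    0 ≤ 1 - 2 / γ * lam m * (1 - δ) := by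
  have h1 : lam m < γ / (2 * (1 - δ)) := (hs.stepsize_le hθ hθ1 hl m).trans_lt hl2
  rw [lt_div_iff₀ (by linarith)] at h1
  have h2 : 2 / γ * lam m * (1 - δ) = lam m * (2 * (1 - δ)) / γ := by ring
  rw [h2, sub_nonneg, div_le_one hγ]
  exact h1.le

/-- The Polyak–Łojasiewicz inequality bounds the squared gradient in the sufficient decrease from
below by `2/γ` times the gap; nonnegativity of the factors lets the estimates be chained. -/
theorem dualObj_sub_le (hs : IsGenerated γ δ θ lamBar G y α₀ α lam)
    (h : IsStrongSubgradient γ (dualObj γ G y) (dualGrad γ G y)) (hγ : 0 < γ) (hδ1 : δ < 1)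
    (hθ : 0 < θ) (hθ1 : θ < 1) (hl : 0 < lamBar) (hl2 : lamBar < γ / (2 * (1 - δ)))
    (z : EuclideanSpace ℝ (Fin n)) (m : ℕ) :
    dualObj γ G y (α m) - dualObj γ G y z ≤
      (∏ i ∈ Finset.range m, (1 - 2 / γ * lam i * (1 - δ))) *
        (dualObj γ G y α₀ - dualObj γ G y z) := by
  induction m with
  | zero => simp [hs.init]
  | succ m ih =>
    have hf := hs.factor_nonneg hγ hδ1 hθ hθ1 hl hl2 m
    have hlam := hs.stepsize_pos hθ hl m
    have h1 := hs.decrease m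
    have h2 := h.sub_le_norm_sq hγ (α m) z
    have h3 : 2 / γ * lam m * (1 - δ) * (dualObj γ G y (α m) - dualObj γ G y z) ≤
        lam m * (1 - δ) * ‖dualGrad γ G y (α m)‖ ^ 2 :=
      calc _ ≤ 2 / γ * lam m * (1 - δ) * (γ / 2 * ‖dualGrad γ G y (α m)‖ ^ 2) :=
            mul_le_mul_of_nonneg_left h2 (mul_nonneg (by positivity) (by linarith))
        _ = _ := by field_simp
    rw [Finset.prod_range_succ]
    calc _ ≤ (1 - 2 / γ * lam m * (1 - δ)) * (dualObj γ G y (α m) - dualObj γ G y z) := by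
          linarith
      _ ≤ (1 - 2 / γ * lam m * (1 - δ)) * _ := mul_le_mul_of_nonneg_left ih hf
      _ = _ := by ring

end IsGenerated

end Linesearch

/-! ### The Gram tensor as a power series in the features -/

section Tensor

variable {𝕂 X : Type*} {q n : ℕ}

theorem summable_abs_pow (hq : 0 < q) (u : lp (fun _ : 𝕂 => ℝ) (q : ℝ≥0∞)) :
    Summable fun k => |u k| ^ q := by
  simpa using (lp.memℓp u).summable (by simpa using hq)

theorem summable_pow (hq : Even q) (hq0 : 0 < q) (u : lp (fun _ : 𝕂 => ℝ) (q : ℝ≥0∞)) :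
    Summable fun k => u k ^ q := by
  simpa only [hq.pow_abs] using summable_abs_pow hq0 u

theorem summable_mul_pow (hq : 0 < q) (v u : lp (fun _ : 𝕂 => ℝ) (q : ℝ≥0∞)) :
    Summable fun k => v k * u k ^ (q - 1) :=
  ((summable_abs_pow hq v).add (summable_abs_pow hq u)).of_norm_bounded
    fun k => abs_mul_pow_le hq (v k) (u k)

/-- At each `k` the product is at most the `q`-th power of its largest factor. -/
theorem summable_prod (hq : 0 < q) (z : Fin q → lp (fun _ : 𝕂 => ℝ) (q : ℝ≥0∞)) :
    Summable fun k => ∏ s, z s k := by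
  have : Nonempty (Fin q) := ⟨⟨0, hq⟩⟩
  refine (summable_sum (s := Finset.univ) fun s _ => summable_abs_pow hq (z s)).of_norm_bounded
    fun k => ?_
  obtain ⟨t, -, ht⟩ := Finset.exists_max_image Finset.univ (fun s => |z s k|)
    Finset.univ_nonempty
  rw [Real.norm_eq_abs, Finset.abs_prod]
  calc ∏ s, |z s k| ≤ ∏ _s : Fin q, |z t k| :=
        Finset.prod_le_prod (fun _ _ => abs_nonneg _) fun s hs => ht s hs
    _ = |z t k| ^ q := by simp
    _ ≤ _ := Finset.single_le_sum (f := fun s => |z s k| ^ q) (fun _ _ => by positivity)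
        (Finset.mem_univ t)

/-- The combination `∑_i α_i Φ(x_i)` of features. -/
def featureSum (Φ : X → lp (fun _ : 𝕂 => ℝ) (q : ℝ≥0∞)) (x : Fin n → X)
    (α : EuclideanSpace ℝ (Fin n)) : lp (fun _ : 𝕂 => ℝ) (q : ℝ≥0∞) :=
  ∑ i, α i • Φ (x i)

variable (Φ : X → lp (fun _ : 𝕂 => ℝ) (q : ℝ≥0∞)) (x : Fin n → X)

theorem featureSum_apply (α : EuclideanSpace ℝ (Fin n)) (k : 𝕂) :
    featureSum Φ x α k = ∑ i, α i * Φ (x i) k :=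
  (congrFun (lp.coeFn_sum (fun i => α i • Φ (x i)) Finset.univ) k).trans
    (Finset.sum_apply k Finset.univ fun i => ⇑(α i • Φ (x i)))

theorem sum_gramTensor (hq : 0 < q) (α : EuclideanSpace ℝ (Fin n)) :
    ∑ i, gramTensor Φ x i * ∏ s, α (i s) = ∑' k, featureSum Φ x α k ^ q := by
  simp_rw [gramTensor, tensorKernel, ← tsum_mul_right]
  rw [← Summable.tsum_finsetSum fun i _ => (summable_prod hq fun s => Φ (x (i s))).mul_right _]
  refine tsum_congr fun k => ?_
  rw [featureSum_apply, ← Fin.prod_const, Finset.prod_univ_sum, Fintype.piFinset_univ]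
  refine Finset.sum_congr rfl fun i _ => ?_
  rw [← Finset.prod_mul_distrib]
  exact Finset.prod_congr rfl fun s _ => mul_comm _ _

theorem prod_lastIndex (hq : 0 < q) (c : Fin n → ℝ) (i : Fin (q - 1) → Fin n) (j : Fin n) :
    ∏ s : Fin q, c (lastIndex i j s) = (∏ s, c (i s)) * c j := by
  obtain ⟨r, rfl⟩ : ∃ r, q = r + 1 := ⟨q - 1, by omega⟩
  rw [Fin.prod_univ_castSucc]
  congr 1
  · exact Finset.prod_congr rfl fun s _ => by simp [lastIndex]
  · simp [lastIndex]

theorem omega_gramTensor (hq : 0 < q) (α : EuclideanSpace ℝ (Fin n)) (j : Fin n) :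
    omega (gramTensor Φ x) α j = ∑' k, Φ (x j) k * featureSum Φ x α k ^ (q - 1) := by
  simp only [omega, gramTensor, tensorKernel]
  simp_rw [← tsum_mul_right]
  rw [← Summable.tsum_finsetSum fun i _ =>
    (summable_prod hq fun s => Φ (x (lastIndex i j s))).mul_right _]
  refine tsum_congr fun k => ?_
  rw [featureSum_apply, ← Fin.prod_const, Finset.prod_univ_sum, Fintype.piFinset_univ,
    Finset.mul_sum]
  refine Finset.sum_congr rfl fun i _ => ?_
  rw [prod_lastIndex hq (fun s => Φ (x s) k), Finset.prod_mul_distrib]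
  ring

theorem inner_omega (hq : 0 < q) (α β : EuclideanSpace ℝ (Fin n)) :
    inner ℝ (omega (gramTensor Φ x) α) β =
      ∑' k, featureSum Φ x β k * featureSum Φ x α k ^ (q - 1) := by
  simp_rw [PiLp.inner_apply, omega_gramTensor Φ x hq, featureSum_apply Φ x β, Finset.sum_mul]
  rw [Summable.tsum_finsetSum fun i _ => by
    simpa only [mul_assoc] using
      (summable_mul_pow hq (Φ (x i)) (featureSum Φ x α)).mul_left (β i)]
  refine Finset.sum_congr rfl fun i _ => ?_
  simp_rw [mul_assoc]
  rw [tsum_mul_left]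
  simp

theorem contDiff_dualGrad (γ : ℝ) (G : (Fin q → Fin n) → ℝ) (y : EuclideanSpace ℝ (Fin n)) :
    ContDiff ℝ 1 (dualGrad γ G y) := by
  have : ContDiff ℝ 1 (omega G) := by
    refine contDiff_euclidean.2 fun j => ?_
    simp only [omega]
    refine ContDiff.sum fun i _ => contDiff_const.mul (contDiff_prod fun s _ => ?_)
    fun_prop
  unfold dualGrad
  fun_prop

theorem summable_powBregman (hq : Even q) (hq0 : 0 < q)
    (u v : lp (fun _ : 𝕂 => ℝ) (q : ℝ≥0∞)) : Summable fun k => powBregman q (u k) (v k) :=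
  (((summable_pow hq hq0 u).div_const _).sub ((summable_pow hq hq0 v).div_const _)).sub
    ((summable_mul_pow hq0 (u - v) v).congr fun k => by simp [mul_comm])

theorem tsum_powBregman (hq : Even q) (hq0 : 0 < q)
    (u v : lp (fun _ : 𝕂 => ℝ) (q : ℝ≥0∞)) :
    ∑' k, powBregman q (u k) (v k) = 1 / (q : ℝ) * ∑' k, u k ^ q - 1 / (q : ℝ) * ∑' k, v k ^ q
      - (∑' k, u k * v k ^ (q - 1) - ∑' k, v k * v k ^ (q - 1)) := by
  have h1 := (summable_pow hq hq0 u).mul_left (1 / (q : ℝ))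
  have h2 := (summable_pow hq hq0 v).mul_left (1 / (q : ℝ))
  have h3 := summable_mul_pow hq0 u v
  have h4 := summable_mul_pow hq0 v v
  rw [← tsum_mul_left, ← tsum_mul_left, ← h1.tsum_sub h2, ← h3.tsum_sub h4,
    ← (h1.sub h2).tsum_sub (h3.sub h4)]
  exact tsum_congr fun k => by rw [powBregman]; ring

/-- Each term contributes its own Bregman distance: the tensor term the series, the quadratic term
`‖b - a‖² / (2γ)`, the linear term nothing. -/
theorem dualObj_bregman (hq : Even q) (hq0 : 0 < q) (γ : ℝ) (y a b : EuclideanSpace ℝ (Fin n)) :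
    dualObj γ (gramTensor Φ x) y b = dualObj γ (gramTensor Φ x) y a
      + inner ℝ (dualGrad γ (gramTensor Φ x) y a) (b - a) + 1 / (2 * γ) * ‖b - a‖ ^ 2
      + ∑' k, powBregman q (featureSum Φ x b k) (featureSum Φ x a k) := by
  rw [tsum_powBregman hq hq0, ← inner_omega Φ x hq0, ← inner_omega Φ x hq0]
  simp only [dualObj, dualGrad, sum_gramTensor Φ x hq0]
  rw [norm_sub_sq_real]
  simp only [inner_add_left, inner_sub_left, inner_sub_right, real_inner_smul_left,
    real_inner_self_eq_norm_sq]
  rw [real_inner_comm b a]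
  ring

theorem isStrongSubgradient_dualGrad (hq : Even q) (hq2 : 2 < q) (γ : ℝ)
    (y : EuclideanSpace ℝ (Fin n)) :
    IsStrongSubgradient γ (dualObj γ (gramTensor Φ x) y) (dualGrad γ (gramTensor Φ x) y) := by
  intro a b
  rw [dualObj_bregman Φ x hq (by omega) γ y a b]
  exact le_add_of_nonneg_right (tsum_nonneg fun k => powBregman_nonneg hq hq2 _ _)

/-- Completing the square: the quadratic and linear terms together are at least `-γ‖y‖²/2`. -/
theorem tsum_pow_le_dualObj {γ : ℝ} (hγ : 0 < γ) (hq : 0 < q)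
    (y a : EuclideanSpace ℝ (Fin n)) :
    ∑' k, featureSum Φ x a k ^ q ≤
      q * (dualObj γ (gramTensor Φ x) y a + γ / 2 * ‖y‖ ^ 2) := by
  have h : 0 ≤ 1 / (2 * γ) * ‖γ • y - a‖ ^ 2 := by positivity
  rw [norm_sub_sq_real, norm_smul, real_inner_smul_left, Real.norm_of_nonneg hγ.le] at h
  have h1 : 1 / (2 * γ) * ((γ * ‖y‖) ^ 2 - 2 * (γ * inner ℝ y a) + ‖a‖ ^ 2)
      = γ / 2 * ‖y‖ ^ 2 - inner ℝ y a + 1 / (2 * γ) * ‖a‖ ^ 2 := by field_simp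
  have hq' : (0 : ℝ) < q := by exact_mod_cast hq
  rw [← div_le_iff₀' hq', dualObj, sum_gramTensor Φ x hq, div_eq_mul_one_div, mul_comm]
  linarith

end Tensor

/-! ### The duality map and primal optimality -/

section Primal

variable {𝕂 X : Type*} {p : ℝ} {q n : ℕ}

theorem dualityMap_apply (hpq : p.HolderConjugate (q : ℝ)) (hq : Even q)
    (u : lp (fun _ : 𝕂 => ℝ) (q : ℝ≥0∞)) (k : 𝕂) : dualityMap hpq u k = u k ^ (q - 1) :=
  sign_mul_abs_pow (Nat.Even.sub_odd (by exact_mod_cast hpq.symm.pos) hq odd_one) _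

theorem hasSum_abs_rpow (hp : 0 < p) (w : lp (fun _ : 𝕂 => ℝ) (ENNReal.ofReal p)) :
    HasSum (fun k => |w k| ^ p) (‖w‖ ^ p) := by
  have := lp.hasSum_norm (p := ENNReal.ofReal p) (by simpa [ENNReal.toReal_ofReal hp.le]) w
  simpa [ENNReal.toReal_ofReal hp.le] using this

theorem summable_mul (hpq : p.HolderConjugate (q : ℝ)) (u : lp (fun _ : 𝕂 => ℝ) (q : ℝ≥0∞))
    (w : lp (fun _ : 𝕂 => ℝ) (ENNReal.ofReal p)) : Summable fun k => u k * w k := by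
  refine (Real.summable_mul_of_Lp_Lq_of_nonneg hpq.symm (fun k => abs_nonneg (u k))
    (fun k => abs_nonneg (w k)) ?_ (hasSum_abs_rpow hpq.pos w).summable).of_norm_bounded
    fun k => (norm_mul _ _).le
  simpa using summable_abs_pow (by exact_mod_cast hpq.symm.pos) u

/-- The Hölder bound for `J_q u - J_q v` in terms of the Bregman distance of `u` and `v`. -/
theorem norm_dualityMap_sub_sq_le (hpq : p.HolderConjugate (q : ℝ)) (hq : Even q) (hq2 : 2 < q)
    (u v : lp (fun _ : 𝕂 => ℝ) (q : ℝ≥0∞)) :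
    ‖dualityMap hpq u - dualityMap hpq v‖ ^ 2 ≤
      2 * (q - 1) * (∑' k, powBregman q (u k) (v k)) *
        (∑' k, u k ^ q + ∑' k, v k ^ q) ^ ((2 - p) / p) := by
  have hp0 := hpq.pos
  have hq' : (2 : ℝ) < q := by exact_mod_cast hq2
  have hpe : p * (q - 1) = q := by rw [mul_comm]; exact hpq.symm.sub_one_mul_conj
  have hp2 : p < 2 := by nlinarith
  have hq0 : 0 < q := by omega
  -- Hölder with exponents `2/p` and `2/(2-p)` separates the Bregman factor from the factor `M ^
  -- (q-2)`.
  have hconj : (2 / p).HolderConjugate (2 / (2 - p)) := by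
    rw [Real.holderConjugate_iff]
    refine ⟨by rw [lt_div_iff₀ hp0]; linarith, ?_⟩
    have : 2 - p ≠ 0 := by linarith
    field_simp
    ring
  set D : 𝕂 → ℝ := fun k => powBregman q (u k) (v k)
  set M : 𝕂 → ℝ := fun k => max |u k| |v k|
  have hD : ∀ k, 0 ≤ 2 * ((q : ℝ) - 1) * D k := fun k =>
    mul_nonneg (by linarith) (powBregman_nonneg hq hq2 _ _)
  have hM : ∀ k, 0 ≤ M k := fun k => le_max_of_le_left (abs_nonneg _)
  have hMq : ∀ k, M k ^ q ≤ u k ^ q + v k ^ q := fun k => by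
    rw [← hq.pow_abs (u k), ← hq.pow_abs (v k)]
    rcases max_choice |u k| |v k| with h | h <;> simp only [M, h]
    · exact le_add_of_nonneg_right (by positivity)
    · exact le_add_of_nonneg_left (by positivity)
  have hDs := (summable_powBregman hq hq0 u v).mul_left (2 * ((q : ℝ) - 1))
  have hus := summable_pow hq hq0 u
  have hvs := summable_pow hq hq0 v
  have hMs : Summable fun k => M k ^ q :=
    (hus.add hvs).of_nonneg_of_le (fun k => pow_nonneg (hM k) q) hMq
  have e1 : ∀ k, ((2 * ((q : ℝ) - 1) * D k) ^ (p / 2)) ^ (2 / p) = 2 * ((q : ℝ) - 1) * D k :=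
    fun k => by
      rw [← Real.rpow_mul (hD k), show p / 2 * (2 / p) = 1 by field_simp, Real.rpow_one]
  have e2 : ∀ k, ((M k ^ q) ^ ((2 - p) / 2)) ^ (2 / (2 - p)) = M k ^ q := fun k => by
    have : 2 - p ≠ 0 := by linarith
    rw [← Real.rpow_mul (pow_nonneg (hM k) q),
      show (2 - p) / 2 * (2 / (2 - p)) = 1 by field_simp, Real.rpow_one]
  have hpt : ∀ k, |(dualityMap hpq u - dualityMap hpq v) k| ^ p ≤
      (2 * ((q : ℝ) - 1) * D k) ^ (p / 2) * (M k ^ q) ^ ((2 - p) / 2) := fun k => by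
    rw [lp.coeFn_sub, Pi.sub_apply, dualityMap_apply hpq hq, dualityMap_apply hpq hq]
    -- From `p(q-1) = q` one gets `q(2-p) = p(q-2)`, so the second factor becomes summable as `M ^
    -- q`.
    have e3 : (M k ^ q) ^ ((2 - p) / 2) = (M k ^ (q - 2)) ^ (p / 2) := by
      rw [← Real.rpow_natCast, ← Real.rpow_mul (hM k), ← Real.rpow_natCast,
        ← Real.rpow_mul (hM k), Nat.cast_sub hq2.le]
      congr 1
      push_cast
      linarith
    have e4 : |u k ^ (q - 1) - v k ^ (q - 1)| ^ p =
        ((u k ^ (q - 1) - v k ^ (q - 1)) ^ 2) ^ (p / 2) := by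
      rw [← sq_abs, ← Real.rpow_natCast (|_|) 2, ← Real.rpow_mul (abs_nonneg _)]
      congr 1
      push_cast
      ring
    rw [e3, e4, ← Real.mul_rpow (hD k) (pow_nonneg (hM k) _)]
    refine Real.rpow_le_rpow (sq_nonneg _) ((sq_pow_sub_pow_le hq hq2 _ _).trans_eq ?_)
      (by positivity)
    ring
  obtain ⟨hs, hle⟩ := Real.summable_and_inner_le_Lp_mul_Lq_tsum_of_nonneg hconj
    (fun k => Real.rpow_nonneg (hD k) (p / 2))
    (fun k => Real.rpow_nonneg (pow_nonneg (hM k) q) ((2 - p) / 2))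
    (by simpa only [e1] using hDs) (by simpa only [e2] using hMs)
  simp only [e1, e2, one_div_div] at hle
  have hsum := hasSum_abs_rpow hp0 (dualityMap hpq u - dualityMap hpq v)
  have hA : 0 ≤ ∑' k, 2 * ((q : ℝ) - 1) * D k := tsum_nonneg hD
  have hB : 0 ≤ ∑' k, M k ^ q := tsum_nonneg fun k => pow_nonneg (hM k) q
  have hfin : ‖dualityMap hpq u - dualityMap hpq v‖ ^ p ≤ _ :=
    ((hsum.tsum_eq ▸ hsum.summable.tsum_le_tsum hpt hs)).trans hle
  have hMle : ∑' k, M k ^ q ≤ ∑' k, u k ^ q + ∑' k, v k ^ q := by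
    rw [← hus.tsum_add hvs]
    exact hMs.tsum_le_tsum hMq (hus.add hvs)
  have hN : (0 : ℝ) ≤ ‖dualityMap hpq u - dualityMap hpq v‖ := lp.norm_nonneg' _
  calc ‖dualityMap hpq u - dualityMap hpq v‖ ^ 2
      = (‖dualityMap hpq u - dualityMap hpq v‖ ^ p) ^ (2 / p) := by
        rw [← Real.rpow_mul hN, mul_div_cancel₀ _ hp0.ne', Real.rpow_ofNat]
    _ ≤ ((∑' k, 2 * ((q : ℝ) - 1) * D k) ^ (p / 2) * (∑' k, M k ^ q) ^ ((2 - p) / 2)) ^ (2 / p) :=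
        Real.rpow_le_rpow (Real.rpow_nonneg hN _) hfin (by positivity)
    _ = (∑' k, 2 * ((q : ℝ) - 1) * D k) * (∑' k, M k ^ q) ^ ((2 - p) / p) := by
        rw [Real.mul_rpow (Real.rpow_nonneg hA _) (Real.rpow_nonneg hB _), ← Real.rpow_mul hA,
          ← Real.rpow_mul hB, show p / 2 * (2 / p) = 1 by field_simp, Real.rpow_one,
          show (2 - p) / 2 * (2 / p) = (2 - p) / p by field_simp]
    _ ≤ _ := by
        rw [tsum_mul_left] at hA ⊢
        exact mul_le_mul_of_nonneg_left (Real.rpow_le_rpow hB hMle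
          (div_nonneg (by linarith) hp0.le)) hA

/-- Since `q - 1` is odd, every real `w` is some `s ^ (q-1)`, and the defect is a Bregman distance.
-/
theorem young_defect_nonneg (hpq : p.HolderConjugate (q : ℝ)) (hq : Even q) (hq2 : 2 < q)
    (t w : ℝ) : 0 ≤ |w| ^ p / p + |t| ^ q / q - t * w := by
  obtain ⟨s, rfl⟩ := exists_pow_eq_of_odd (Nat.Even.sub_odd (by omega) hq odd_one : Odd (q - 1)) w
  rw [young_defect hpq hq]
  exact powBregman_nonneg hq hq2 t s

theorem eq_pow_of_young_defect_eq_zero (hpq : p.HolderConjugate (q : ℝ)) (hq : Even q)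
    (hq2 : 2 < q) {t w : ℝ} (h : |w| ^ p / p + |t| ^ q / q - t * w = 0) : w = t ^ (q - 1) := by
  obtain ⟨s, rfl⟩ := exists_pow_eq_of_odd (Nat.Even.sub_odd (by omega) hq odd_one : Odd (q - 1)) w
  rw [young_defect hpq hq] at h
  exact (pow_eq_pow_of_powBregman_eq_zero hq hq2 h).symm

theorem hasSum_young_defect (hpq : p.HolderConjugate (q : ℝ))
    (u : lp (fun _ : 𝕂 => ℝ) (q : ℝ≥0∞)) (w : lp (fun _ : 𝕂 => ℝ) (ENNReal.ofReal p)) :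
    HasSum (fun k => |w k| ^ p / p + |u k| ^ q / q - u k * w k)
      (‖w‖ ^ p / p + (∑' k, |u k| ^ q) / q - pairing u w) :=
  (((hasSum_abs_rpow hpq.pos w).div_const p).add
    ((summable_abs_pow (by exact_mod_cast hpq.symm.pos) u).hasSum.div_const (q : ℝ))).sub
    (summable_mul hpq u w).hasSum

/-- `J_q u` is the unique minimizer of `w ↦ ‖w‖_p^p / p - ⟨u, w⟩`. -/
theorem norm_rpow_sub_pairing_lt (hpq : p.HolderConjugate (q : ℝ)) (hq : Even q) (hq2 : 2 < q)
    (u : lp (fun _ : 𝕂 => ℝ) (q : ℝ≥0∞)) {w : lp (fun _ : 𝕂 => ℝ) (ENNReal.ofReal p)}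
    (hw : w ≠ dualityMap hpq u) :
    ‖dualityMap hpq u‖ ^ p / p - pairing u (dualityMap hpq u) < ‖w‖ ^ p / p - pairing u w := by
  have h0 : ‖dualityMap hpq u‖ ^ p / p + (∑' k, |u k| ^ q) / q - pairing u (dualityMap hpq u) = 0 :=
    (hasSum_young_defect hpq u (dualityMap hpq u)).unique <| by
      convert hasSum_zero (α := ℝ) (β := 𝕂) using 2 with k
      rw [dualityMap_apply hpq hq, young_defect hpq hq]
      simp [powBregman]
  have h1 := hasSum_young_defect hpq u w
  have hnn : ∀ k, 0 ≤ |w k| ^ p / p + |u k| ^ q / q - u k * w k := fun k =>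
    young_defect_nonneg hpq hq hq2 _ _
  have h2 : ‖w‖ ^ p / p + (∑' k, |u k| ^ q) / q - pairing u w ≠ 0 := fun h => by
    rw [h, hasSum_zero_iff_of_nonneg hnn] at h1
    refine hw (lp.ext (funext fun k => ?_))
    rw [dualityMap_apply hpq hq]
    exact eq_pow_of_young_defect_eq_zero hpq hq hq2 (congrFun h1 k)
  have h3 := (h1.nonneg hnn).lt_of_ne' h2
  linarith

variable (Φ : X → lp (fun _ : 𝕂 => ℝ) (q : ℝ≥0∞)) (x : Fin n → X)

theorem pairing_featureSum (hpq : p.HolderConjugate (q : ℝ)) (α : EuclideanSpace ℝ (Fin n))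
    (w : lp (fun _ : 𝕂 => ℝ) (ENNReal.ofReal p)) :
    pairing (featureSum Φ x α) w = ∑ i, α i * pairing (Φ (x i)) w := by
  simp_rw [pairing, ← tsum_mul_left]
  rw [← Summable.tsum_finsetSum fun i _ => (summable_mul hpq (Φ (x i)) w).mul_left (α i)]
  refine tsum_congr fun k => ?_
  rw [featureSum_apply, Finset.sum_mul]
  exact Finset.sum_congr rfl fun i _ => mul_assoc _ _ _

theorem pairing_primalPoint (hpq : p.HolderConjugate (q : ℝ)) (hq : Even q)
    (α : EuclideanSpace ℝ (Fin n)) (j : Fin n) :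
    pairing (Φ (x j)) (primalPoint hpq Φ x α) = omega (gramTensor Φ x) α j := by
  rw [omega_gramTensor Φ x (by exact_mod_cast hpq.symm.pos)]
  exact tsum_congr fun k => by rw [primalPoint, dualityMap_apply hpq hq, featureSum]

/-- A vanishing dual gradient says that `a` is `γ` times the primal residual. The tangent inequality
for the squares and the strict Young bound for the norm then carry opposite linear terms, which
cancel on adding. -/
theorem primalObj_lt (hpq : p.HolderConjugate (q : ℝ)) (hq : Even q) (hq2 : 2 < q) {γ : ℝ}
    (hγ : 0 < γ) {y a : EuclideanSpace ℝ (Fin n)} (ha : dualGrad γ (gramTensor Φ x) y a = 0)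
    {w : lp (fun _ : 𝕂 => ℝ) (ENNReal.ofReal p)} (hw : w ≠ primalPoint hpq Φ x a) :
    primalObj p γ Φ x y (primalPoint hpq Φ x a) < primalObj p γ Φ x y w := by
  have hres : ∀ i, a i = γ * (y i - pairing (Φ (x i)) (primalPoint hpq Φ x a)) := fun i => by
    have h := congrArg (fun v : EuclideanSpace ℝ (Fin n) => v i) ha
    simp only [dualGrad, PiLp.add_apply, PiLp.sub_apply, PiLp.smul_apply, smul_eq_mul,
      PiLp.zero_apply] at h
    rw [pairing_primalPoint Φ x hpq hq]
    field_simp at h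
    linarith
  have h1 := norm_rpow_sub_pairing_lt hpq hq hq2 (featureSum Φ x a) hw
  change ‖primalPoint hpq Φ x a‖ ^ p / p - pairing (featureSum Φ x a) (primalPoint hpq Φ x a) < _
    at h1
  rw [pairing_featureSum Φ x hpq, pairing_featureSum Φ x hpq] at h1
  have h2 : γ / 2 * ∑ i, (y i - pairing (Φ (x i)) (primalPoint hpq Φ x a)) ^ 2
      + ∑ i, a i * pairing (Φ (x i)) (primalPoint hpq Φ x a)
      ≤ γ / 2 * ∑ i, (y i - pairing (Φ (x i)) w) ^ 2 + ∑ i, a i * pairing (Φ (x i)) w := by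
    rw [Finset.mul_sum, Finset.mul_sum, ← Finset.sum_add_distrib, ← Finset.sum_add_distrib]
    refine Finset.sum_le_sum fun i _ => ?_
    rw [hres i]
    have := mul_nonneg hγ.le
      (sq_nonneg (pairing (Φ (x i)) w - pairing (Φ (x i)) (primalPoint hpq Φ x a)))
    linarith
  simp only [primalObj, one_div_mul_eq_div]
  linarith

end Primal

/-! ### From the dual gap to the primal distance -/

section Rate

variable {𝕂 X : Type*} {p : ℝ} {q n : ℕ}

/-- The distance of the primal points is controlled by the dual gap. -/
theorem norm_primalPoint_sub_sq_le (hpq : p.HolderConjugate (q : ℝ)) (hq : Even q) (hq2 : 2 < q)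
    (Φ : X → lp (fun _ : 𝕂 => ℝ) (q : ℝ≥0∞)) (x : Fin n → X) {γ : ℝ} (hγ : 0 < γ)
    {y z : EuclideanSpace ℝ (Fin n)} (hz : dualGrad γ (gramTensor Φ x) y z = 0)
    {a : EuclideanSpace ℝ (Fin n)} {c : ℝ} (ha : dualObj γ (gramTensor Φ x) y a ≤ c) :
    ‖primalPoint hpq Φ x a - primalPoint hpq Φ x z‖ ^ 2 ≤
      ((2 ^ p * q) * (c + γ / 2 * ‖y‖ ^ 2)) ^ ((2 - p) / p) / ((p - 1) / 2) *
        (dualObj γ (gramTensor Φ x) y a - dualObj γ (gramTensor Φ x) y z) := by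
  have hp0 := hpq.pos
  have hp1 := hpq.lt
  have hq0 : 0 < q := by omega
  have hq' : (2 : ℝ) < q := by exact_mod_cast hq2
  have hpe : (p - 1) * (q - 1) = 1 := by
    linarith [hpq.mul_eq_add]
  have hp2 : p < 2 := by nlinarith
  have hsub := isStrongSubgradient_dualGrad Φ x hq hq2 γ y
  have hza : dualObj γ (gramTensor Φ x) y z ≤ dualObj γ (gramTensor Φ x) y a :=
    hsub.isMinOn_of_eq hγ hz (mem_univ a)
  have hD : ∑' k, powBregman q (featureSum Φ x a k) (featureSum Φ x z k) ≤
      dualObj γ (gramTensor Φ x) y a - dualObj γ (gramTensor Φ x) y z := by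
    have h := dualObj_bregman Φ x hq hq0 γ y z a
    rw [hz, inner_zero_left] at h
    have : 0 ≤ 1 / (2 * γ) * ‖a - z‖ ^ 2 := by positivity
    linarith
  have hua := tsum_pow_le_dualObj Φ x hγ hq0 y a
  have huz := tsum_pow_le_dualObj Φ x hγ hq0 y z
  have hna : 0 ≤ ∑' k, featureSum Φ x a k ^ q := tsum_nonneg fun k => hq.pow_nonneg _
  have hnz : 0 ≤ ∑' k, featureSum Φ x z k ^ q := tsum_nonneg fun k => hq.pow_nonneg _
  have hc : q * (dualObj γ (gramTensor Φ x) y a + γ / 2 * ‖y‖ ^ 2) ≤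
      q * (c + γ / 2 * ‖y‖ ^ 2) := by gcongr
  have hc' : q * (dualObj γ (gramTensor Φ x) y z + γ / 2 * ‖y‖ ^ 2) ≤
      q * (c + γ / 2 * ‖y‖ ^ 2) := by gcongr; exact hza.trans ha
  -- The two energies add up to at most twice the common bound; `2` is relaxed to `2 ^ p` to match
  -- the stated constant.
  have h2p : (2 : ℝ) ≤ 2 ^ p := by
    simpa using Real.rpow_le_rpow_of_exponent_le one_le_two hp1.le
  have hS : ∑' k, featureSum Φ x a k ^ q + ∑' k, featureSum Φ x z k ^ q ≤
      (2 ^ p * q) * (c + γ / 2 * ‖y‖ ^ 2) :=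
    calc _ ≤ 2 * (q * (c + γ / 2 * ‖y‖ ^ 2)) := by linarith
      _ ≤ 2 ^ p * (q * (c + γ / 2 * ‖y‖ ^ 2)) :=
          mul_le_mul_of_nonneg_right h2p (by linarith)
      _ = _ := by ring
  calc _ ≤ 2 * (q - 1) * (∑' k, powBregman q (featureSum Φ x a k) (featureSum Φ x z k)) *
        (∑' k, featureSum Φ x a k ^ q + ∑' k, featureSum Φ x z k ^ q) ^ ((2 - p) / p) :=
        norm_dualityMap_sub_sq_le hpq hq hq2 (featureSum Φ x a) (featureSum Φ x z)
    _ ≤ 2 * (q - 1) * (dualObj γ (gramTensor Φ x) y a - dualObj γ (gramTensor Φ x) y z) *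
        ((2 ^ p * q) * (c + γ / 2 * ‖y‖ ^ 2)) ^ ((2 - p) / p) := by
        have h2q : (0 : ℝ) ≤ 2 * (q - 1) := by linarith
        exact mul_le_mul (mul_le_mul_of_nonneg_left hD h2q)
          (Real.rpow_le_rpow (by positivity) hS (div_nonneg (by linarith) hp0.le))
          (by positivity) (mul_nonneg h2q (by linarith))
    -- Here `q - 1 = 1/(p - 1)` turns `2(q - 1)` into the reciprocal of `(p - 1)/2`.
    _ = _ := by
        have : (q : ℝ) - 1 = (p - 1)⁻¹ := eq_inv_of_mul_eq_one_right hpe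
        rw [this]
        field_simp

end Rate

end TensorKernel
end
-- The main theorem
open TensorKernel in
theorem theorem1 :
    ∃ C : ℝ → ℝ, (∀ p, 1 < p → p < 2 → 0 < C p) ∧ Tendsto C (𝓝[>] 1) (𝓝 0) ∧
      ∀ (q : ℕ) (p : ℝ) (_ : Even q) (_ : 2 < q) (hpq : p.HolderConjugate (q : ℝ))
        (𝕂 : Type*) [Countable 𝕂] (X : Type*) (Φ : X → lp (fun _ : 𝕂 => ℝ) (q : ℝ≥0∞))
        (n : ℕ) (x : Fin n → X) (y : EuclideanSpace ℝ (Fin n))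
        (γ δ θ lamBar : ℝ), 0 < γ → 0 < δ → δ < 1 → 0 < θ → θ < 1 →
        0 < lamBar → lamBar < γ / (2 * (1 - δ)) →
        -- the algorithm computes the gradient of the dual objective
        (∀ a, HasGradientAt (dualObj γ (gramTensor Φ x) y) (dualGrad γ (gramTensor Φ x) y a) a) ∧
        -- from every starting point the algorithm is well defined
        (∀ α₀, ∃! s : (ℕ → EuclideanSpace ℝ (Fin n)) × (ℕ → ℝ),
          IsGenerated γ δ θ lamBar (gramTensor Φ x) y α₀ s.1 s.2) ∧
        -- the primal and the dual problem have exactly one solution each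
        ∃ wBar αBar,
          (∀ w, IsMinOn (primalObj p γ Φ x y) univ w ↔ w = wBar) ∧
          (∀ a, IsMinOn (dualObj γ (gramTensor Φ x) y) univ a ↔ a = αBar) ∧
          ∀ (α₀ : EuclideanSpace ℝ (Fin n)) (α : ℕ → EuclideanSpace ℝ (Fin n)) (lam : ℕ → ℝ),
            IsGenerated γ δ θ lamBar (gramTensor Φ x) y α₀ α lam →
            -- the stepsizes stay away from zero
            0 < ⨅ m, lam m ∧
            -- the bound, with the contraction factors of the steps taken so far
            (∀ m, ‖primalPoint hpq Φ x (α m) - wBar‖ ^ 2 ≤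
              ((2 ^ p * q) * (dualObj γ (gramTensor Φ x) y α₀ + γ / 2 * ‖y‖ ^ 2)) ^ ((2 - p) / p)
                / C p
              * (∏ i ∈ Finset.range m, (1 - 2 / γ * lam i * (1 - δ)))
              * (dualObj γ (gramTensor Φ x) y α₀ - dualObj γ (gramTensor Φ x) y αBar)) ∧
            -- the bound with the power of a single factor, for the smallest stepsize so far
            (∀ m, (∀ i < m, lam m ≤ lam i) →
              ‖primalPoint hpq Φ x (α m) - wBar‖ ^ 2 ≤
              ((2 ^ p * q) * (dualObj γ (gramTensor Φ x) y α₀ + γ / 2 * ‖y‖ ^ 2)) ^ ((2 - p) / p)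
                / C p
              * (1 - 2 / γ * lam m * (1 - δ)) ^ m
              * (dualObj γ (gramTensor Φ x) y α₀ - dualObj γ (gramTensor Φ x) y αBar)) ∧
            -- linear convergence, with the ratio given by the infimum of the stepsizes
            0 ≤ 1 - 2 / γ * (⨅ i, lam i) * (1 - δ) ∧
            1 - 2 / γ * (⨅ i, lam i) * (1 - δ) < 1 ∧
            (∀ m, ‖primalPoint hpq Φ x (α m) - wBar‖ ^ 2 ≤
              ((2 ^ p * q) * (dualObj γ (gramTensor Φ x) y α₀ + γ / 2 * ‖y‖ ^ 2)) ^ ((2 - p) / p)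
                / C p
              * (1 - 2 / γ * (⨅ i, lam i) * (1 - δ)) ^ m
              * (dualObj γ (gramTensor Φ x) y α₀ - dualObj γ (gramTensor Φ x) y αBar)) := by
  refine ⟨fun p => (p - 1) / 2, fun p hp _ => by linarith, ?_, ?_⟩
  · have h : Continuous fun p : ℝ => (p - 1) / 2 := by fun_prop
    simpa using (h.tendsto 1).mono_left nhdsWithin_le_nhds
  intro q p hq hq2 hpq 𝕂 _ X Φ n x y γ δ θ lamBar hγ hδ hδ1 hθ hθ1 hl hl2
  have hsub := isStrongSubgradient_dualGrad Φ x hq hq2 γ y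
  have hg := contDiff_dualGrad γ (gramTensor Φ x) y
  obtain ⟨z, hz⟩ := hsub.exists_eq_zero hγ hg.continuous
  refine ⟨hsub.hasGradientAt hγ hg.continuous,
    existsUnique_isGenerated hsub hγ hg hδ hθ hθ1 hl, primalPoint hpq Φ x z, z,
    fun w => ⟨fun hw => ?_, ?_⟩,
    fun a => ⟨fun ha => hsub.eq_zero_unique hγ hz (hsub.eq_of_isMinOn hγ hg.continuous ha), ?_⟩,
    fun α₀ α lam hs => ?_⟩
  · by_contra hne
    exact (primalObj_lt Φ x hpq hq hq2 hγ hz hne).not_ge (hw (mem_univ _))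
  · rintro rfl w -
    change primalObj p γ Φ x y _ ≤ primalObj p γ Φ x y w
    rcases eq_or_ne w (primalPoint hpq Φ x z) with rfl | hne
    · exact le_rfl
    · exact (primalObj_lt Φ x hpq hq hq2 hγ hz hne).le
  · rintro rfl
    exact hsub.isMinOn_of_eq hγ hz
  have hmin : ∀ a, dualObj γ (gramTensor Φ x) y z ≤ dualObj γ (gramTensor Φ x) y a :=
    fun a => hsub.isMinOn_of_eq hγ hz (mem_univ a)
  have hgap : 0 ≤ dualObj γ (gramTensor Φ x) y α₀ - dualObj γ (gramTensor Φ x) y z :=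
    sub_nonneg.2 (hmin α₀)
  have hE : 0 ≤ dualObj γ (gramTensor Φ x) y α₀ + γ / 2 * ‖y‖ ^ 2 := by
    have h1 := tsum_pow_le_dualObj Φ x hγ (by omega) y α₀
    have h2 : 0 ≤ ∑' k, featureSum Φ x α₀ k ^ q := tsum_nonneg fun k => hq.pow_nonneg _
    exact nonneg_of_mul_nonneg_right (h2.trans h1) (by exact_mod_cast (by omega : 0 < q))
  have hp1 : 0 < p - 1 := sub_pos.2 hpq.lt
  set A := ((2 ^ p * q) * (dualObj γ (gramTensor Φ x) y α₀ + γ / 2 * ‖y‖ ^ 2)) ^ ((2 - p) / p)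
    / ((p - 1) / 2)
  have hA : 0 ≤ A := by positivity
  have hfac := hs.factor_nonneg hγ hδ1 hθ hθ1 hl hl2
  have hinf := hs.iInf_stepsize_pos hsub hγ hg hδ hδ1 hθ hθ1 hl
  have hfactor_le : ∀ {s t : ℝ}, s ≤ t → 1 - 2 / γ * t * (1 - δ) ≤ 1 - 2 / γ * s * (1 - δ) :=
    fun hst => by
      have : 0 ≤ 1 - δ := by linarith
      gcongr
  have hbound : ∀ m, ‖primalPoint hpq Φ x (α m) - primalPoint hpq Φ x z‖ ^ 2 ≤
      A * (∏ i ∈ Finset.range m, (1 - 2 / γ * lam i * (1 - δ)))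
        * (dualObj γ (gramTensor Φ x) y α₀ - dualObj γ (gramTensor Φ x) y z) := fun m => by
    rw [mul_assoc]
    exact (norm_primalPoint_sub_sq_le hpq hq hq2 Φ x hγ hz (hs.dualObj_le hδ1 hθ hl m)).trans
      (mul_le_mul_of_nonneg_left (hs.dualObj_sub_le hsub hγ hδ1 hθ hθ1 hl hl2 z m) hA)
  -- Any lower bound `t` for the earlier steps yields a power bound; `t = lam m` and `t = ⨅ i, lam
  -- i` give the two stated forms.
  have hpow : ∀ (m : ℕ) (t : ℝ), (∀ i < m, t ≤ lam i) →
      ‖primalPoint hpq Φ x (α m) - primalPoint hpq Φ x z‖ ^ 2 ≤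
      A * (1 - 2 / γ * t * (1 - δ)) ^ m
        * (dualObj γ (gramTensor Φ x) y α₀ - dualObj γ (gramTensor Φ x) y z) := fun m t ht => by
    refine (hbound m).trans (mul_le_mul_of_nonneg_right (mul_le_mul_of_nonneg_left ?_ hA) hgap)
    calc _ ≤ ∏ _i ∈ Finset.range m, (1 - 2 / γ * t * (1 - δ)) :=
          Finset.prod_le_prod (fun i _ => hfac i)
            fun i hi => hfactor_le (ht i (Finset.mem_range.1 hi))
      _ = _ := by simp
  refine ⟨hinf, hbound, fun m hm => hpow m (lam m) hm, ?_, ?_,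
    fun m => hpow m _ fun i _ => hs.iInf_stepsize_le hθ hl i⟩
  · exact (hfac 0).trans (hfactor_le (hs.iInf_stepsize_le hθ hl 0))
  · have : 0 < 2 / γ * (⨅ i, lam i) * (1 - δ) := mul_pos (by positivity) (by linarith)
    linarith
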